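/- Let $(\Omega,\mathcal F,\mathbb P)$ be a probability space and let $W(0),W(1),\dots$ be a sequence of random $m\times m$ matrices with measurable entries, each realization of each $W(k)$ being row-stochastic (nonnegative entries, every row summing to $1$). For $t_0\ge 0$ and $x(t_0)\in\mathbb R^m$, let $x(k+1)=W(k)x(k)$ for $k\ge t_0$. Suppose that $\{W(k)\}$ belongs to the class $\mathscr M_2$, i.e. the matrices $W(k)$ are independent and, with $H(k)=\mathbb E[W(k)^TW(k)]$, $$\sum_{k=t_0}^{\infty}\ \sum_{1\le i<j\le m}H_{ij}(k)\,\mathbb E\big[(x_i(k)-x_j(k))^2\big]<\infty\qquad\text{for every } t_0\ge 0 \text{ and every (deterministic) } x(t_0)\in\mathbb R^m .$$ Suppose also that $\{W(k)\}$ has the weak feedback property, i.e. there is $\gamma>0$ such that, with $W^i(k)$ denoting the $i$-th column of $W(k)$, $$\mathbb E\big[W^i(k)^TW^j(k)\big]\ \ge\ \gamma\,\big(\mathbb E[W_{ij}(k)]+\mathbb E[W_{ji}(k)]\big)\qquad\text{for all } k\ge 0 \text{ and all } i\ne j .$$ Then $\{W(k)\}$ is ergodic if and only if it has the infinite flow property.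 Here $\{W(k)\}$ is ergodic if, almost surely, $\lim_{k\to\infty}(x_i(k)-x_j(k))=0$ for all $i,j$, every starting time $t_0\ge0$ and every starting point $x(t_0)\in\mathbb R^m$; and it has the infinite flow property if, almost surely, $\sum_{k=0}^{\infty}\sum_{i\in S,\,j\notin S}(W_{ij}(k)+W_{ji}(k))=\infty$ for every nonempty proper subset $S$ of $\{1,\dots,m\}$. -/

import Mathlib

open MeasureTheory ProbabilityTheory Filter Topology
open scoped Matrix

namespace RandomChain

/-- `state A t₀ x₀ n` is the state at time `t₀ + n` of the linear dynamics
`x(k+1) = A(k) x(k)` for `k ≥ t₀`, started at `x(t₀) = x₀`. -/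
def state {m : ℕ} (A : ℕ → Matrix (Fin m) (Fin m) ℝ) (t₀ : ℕ) (x₀ : Fin m → ℝ) :
    ℕ → Fin m → ℝ
  | 0 => x₀
  | n + 1 => A (t₀ + n) *ᵥ state A t₀ x₀ n

/-- Ergodicity of a deterministic chain: all coordinate differences of the dynamics vanish in the
limit, for every starting time and every starting point. -/
def IsErgodicChain {m : ℕ} (A : ℕ → Matrix (Fin m) (Fin m) ℝ) : Prop :=
  ∀ (t₀ : ℕ) (x₀ : Fin m → ℝ) (i j : Fin m),
    Tendsto (fun n => state A t₀ x₀ n i - state A t₀ x₀ n j) atTop (𝓝 0)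

/-- The flow `A_S = ∑_{i ∈ S, j ∉ S} (A_{ij} + A_{ji})` between `S` and its complement. -/
def flow {m : ℕ} (A : Matrix (Fin m) (Fin m) ℝ) (S : Finset (Fin m)) : ℝ :=
  ∑ i ∈ S, ∑ j ∈ Sᶜ, (A i j + A j i)

/-- The infinite flow property of a deterministic chain: `∑_k A_S(k) = ∞` for every nonempty
proper subset `S` of the index set. -/
def HasInfiniteFlowChain {m : ℕ} (A : ℕ → Matrix (Fin m) (Fin m) ℝ) : Prop :=
  ∀ S : Finset (Fin m), S.Nonempty → S ≠ Finset.univ →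
    Tendsto (fun n => ∑ k ∈ Finset.range n, flow (A k) S) atTop atTop

section Random

variable {m : ℕ} {Ω : Type*} [MeasurableSpace Ω]

/-- A random model: every realization of every `W(k)` is a (row-)stochastic matrix, and all the
entries are random variables. -/
structure IsRandomModel (W : ℕ → Ω → Matrix (Fin m) (Fin m) ℝ) : Prop where
  stochastic : ∀ k ω, W k ω ∈ Matrix.rowStochastic ℝ (Fin m)
  measurable : ∀ k i j, Measurable fun ω => W k ω i j

/-- The matrices `W(0), W(1), …` are (mutually) independent; a matrix is regarded as the family of
its entries. -/
def IsIndependent (P : Measure Ω) (W : ℕ → Ω → Matrix (Fin m) (Fin m) ℝ) : Prop :=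
  iIndepFun (fun k ω => (fun i j => W k ω i j : Fin m → Fin m → ℝ)) P

/-- `H(k) = E[W(k)ᵀ W(k)]`, entrywise. -/
noncomputable def H (P : Measure Ω) (W : ℕ → Ω → Matrix (Fin m) (Fin m) ℝ) (k : ℕ) :
    Matrix (Fin m) (Fin m) ℝ :=
  Matrix.of fun i j => ∫ ω, ((W k ω)ᵀ * W k ω) i j ∂P

/-- The class `𝓜₂`: independent random models such that, for every starting time `t₀` and every
deterministic starting point `x₀`, the series
`∑_{k ≥ t₀} ∑_{i < j} H_{ij}(k) E[(x_i(k) - x_j(k))²]` (of nonnegative terms) is finite. -/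
structure IsClassM2 (P : Measure Ω) (W : ℕ → Ω → Matrix (Fin m) (Fin m) ℝ) : Prop where
  isRandomModel : IsRandomModel W
  isIndependent : IsIndependent P W
  summable : ∀ (t₀ : ℕ) (x₀ : Fin m → ℝ),
    Summable fun n : ℕ => ∑ i : Fin m, ∑ j ∈ Finset.Ioi i,
      H P W (t₀ + n) i j *
        ∫ ω, (state (fun k => W k ω) t₀ x₀ n i - state (fun k => W k ω) t₀ x₀ n j) ^ 2 ∂P

/-- The weak feedback property; `(W k ω)ᵀ i` is the `i`-th column of `W(k)`. -/
def HasWeakFeedback (P : Measure Ω) (W : ℕ → Ω → Matrix (Fin m) (Fin m) ℝ) : Prop :=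
  ∃ γ : ℝ, 0 < γ ∧ ∀ (k : ℕ) (i j : Fin m), i ≠ j →
    γ * ((∫ ω, W k ω i j ∂P) + ∫ ω, W k ω j i ∂P) ≤ ∫ ω, (W k ω)ᵀ i ⬝ᵥ (W k ω)ᵀ j ∂P

/-- A random model is ergodic if almost every realization is an ergodic chain. -/
def IsErgodic (P : Measure Ω) (W : ℕ → Ω → Matrix (Fin m) (Fin m) ℝ) : Prop :=
  ∀ᵐ ω ∂P, IsErgodicChain fun k => W k ω

/-- A random model has the infinite flow property if almost every realization has it. -/
def HasInfiniteFlow (P : Measure Ω) (W : ℕ → Ω → Matrix (Fin m) (Fin m) ℝ) : Prop :=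
  ∀ᵐ ω ∂P, HasInfiniteFlowChain fun k => W k ω

end Random

end RandomChain

/-! Averaging by a row-stochastic matrix never increases the spread of a trajectory, and a gap
between the values on `S` and those off `S` closes only through flow across `S`
(`sub_mul_flow_le_state_sub`). If some `S` has finite total flow, starting late enough from its
indicator keeps a gap forever. Hence ergodicity forces infinite flow, realization by realization.

Conversely, call `∑ i, ∑ j, (W i j + W j i) * (x i - x j) ^ 2` the dissipation of a step. A state of
spread at least `ε` has a gap across some `S` (`exists_gap`). Infinite flow makes the flow over `S`
pass a fixed threshold while the gap is still half open, which costs a fixed amount of dissipation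
(`exists_le_sum_dissipation`). Finite total dissipation therefore forces consensus. Probability
enters only to show that the total dissipation is almost surely finite: `W(k)` is independent of
`x(k)`, so expectations factor, and weak feedback bounds the expected dissipation by the series that
is finite in the class `𝓜₂`. -/

namespace RandomChain

/-! ### Deterministic chains: spread, gaps, flow and dissipation -/

section Deterministic

variable {m : ℕ} {A : ℕ → Matrix (Fin m) (Fin m) ℝ}

theorem state_add (A : ℕ → Matrix (Fin m) (Fin m) ℝ) (t₀ : ℕ) (x₀ : Fin m → ℝ) (n k : ℕ) :
    state A t₀ x₀ (n + k) = state A (t₀ + n) (state A t₀ x₀ n) k := by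
  induction k with
  | zero => rfl
  | succ k ih =>
    rw [← add_assoc]
    simp only [state]
    rw [ih, add_assoc]

/-- The state depends only on the matrices applied so far. -/
theorem state_congr {B : ℕ → Matrix (Fin m) (Fin m) ℝ} {t₀ n : ℕ} (x₀ : Fin m → ℝ)
    (h : ∀ k < t₀ + n, A k = B k) : state A t₀ x₀ n = state B t₀ x₀ n := by
  induction n with
  | zero => rfl
  | succ n ih =>
    simp only [state]
    rw [ih fun k hk => h k (by omega), h (t₀ + n) (by omega)]

theorem state_eq_sum_single (A : ℕ → Matrix (Fin m) (Fin m) ℝ) (t₀ : ℕ) (x₀ : Fin m → ℝ)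
    (n : ℕ) : state A t₀ x₀ n = ∑ l, x₀ l • state A t₀ (Pi.single l 1) n := by
  induction n with
  | zero => exact pi_eq_sum_univ' x₀
  | succ n ih =>
    simp only [state]
    rw [ih, Matrix.mulVec_sum]
    simp only [Matrix.mulVec_smul]

theorem flow_nonneg {B : Matrix (Fin m) (Fin m) ℝ} (hB : B ∈ Matrix.rowStochastic ℝ (Fin m))
    (S : Finset (Fin m)) : 0 ≤ flow B S :=
  Finset.sum_nonneg fun _ _ => Finset.sum_nonneg fun _ _ =>
    add_nonneg (Matrix.nonneg_of_mem_rowStochastic hB) (Matrix.nonneg_of_mem_rowStochastic hB)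

theorem sum_compl_row_le_flow {B : Matrix (Fin m) (Fin m) ℝ}
    (hB : B ∈ Matrix.rowStochastic ℝ (Fin m)) {S : Finset (Fin m)} {i : Fin m} (hi : i ∈ S) :
    ∑ j ∈ Sᶜ, B i j ≤ flow B S := by
  have h0 : ∀ i j, 0 ≤ B i j := fun i j => Matrix.nonneg_of_mem_rowStochastic hB
  refine le_trans ?_ (Finset.single_le_sum (f := fun i => ∑ j ∈ Sᶜ, (B i j + B j i))
    (fun i _ => Finset.sum_nonneg fun j _ => add_nonneg (h0 i j) (h0 j i)) hi)
  exact Finset.sum_le_sum fun j _ => le_add_of_nonneg_right (h0 j i)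

theorem flow_compl (B : Matrix (Fin m) (Fin m) ℝ) (S : Finset (Fin m)) :
    flow B Sᶜ = flow B S := by
  unfold flow
  rw [compl_compl, Finset.sum_comm]
  simp only [add_comm]

theorem mulVec_le {B : Matrix (Fin m) (Fin m) ℝ} (hB : B ∈ Matrix.rowStochastic ℝ (Fin m))
    {x : Fin m → ℝ} {c : ℝ} (hx : ∀ i, x i ≤ c) (i : Fin m) : (B *ᵥ x) i ≤ c := by
  calc ∑ j, B i j * x j ≤ ∑ j, B i j * c := Finset.sum_le_sum fun j _ =>
        mul_le_mul_of_nonneg_left (hx j) (Matrix.nonneg_of_mem_rowStochastic hB)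
    _ = c := by rw [← Finset.sum_mul, Matrix.sum_row_of_mem_rowStochastic hB, one_mul]

theorem state_neg (A : ℕ → Matrix (Fin m) (Fin m) ℝ) (t₀ : ℕ) (x₀ : Fin m → ℝ) (n : ℕ) :
    state A t₀ (-x₀) n = -state A t₀ x₀ n := by
  induction n with
  | zero => rfl
  | succ n ih =>
    simp only [state]
    rw [ih, Matrix.mulVec_neg]

theorem state_le (hA : ∀ k, A k ∈ Matrix.rowStochastic ℝ (Fin m)) (t₀ : ℕ) {x₀ : Fin m → ℝ}
    {c : ℝ} (hx : ∀ i, x₀ i ≤ c) (n : ℕ) (i : Fin m) : state A t₀ x₀ n i ≤ c := by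
  induction n generalizing i with
  | zero => exact hx i
  | succ n ih => exact mulVec_le (hA _) ih i

theorem le_state (hA : ∀ k, A k ∈ Matrix.rowStochastic ℝ (Fin m)) (t₀ : ℕ) {x₀ : Fin m → ℝ}
    {c : ℝ} (hx : ∀ i, c ≤ x₀ i) (n : ℕ) (i : Fin m) : c ≤ state A t₀ x₀ n i := by
  have h := state_le hA t₀ (x₀ := -x₀) (c := -c) (fun i => neg_le_neg (hx i)) n i
  rw [state_neg] at h
  exact neg_le_neg_iff.1 h

theorem abs_state_sub_le (hA : ∀ k, A k ∈ Matrix.rowStochastic ℝ (Fin m)) (t₀ : ℕ)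
    {x₀ : Fin m → ℝ} {c : ℝ} (hx : ∀ i j, x₀ i - x₀ j ≤ c) (n : ℕ) (i j : Fin m) :
    |state A t₀ x₀ n i - state A t₀ x₀ n j| ≤ c := by
  have h (i j : Fin m) : state A t₀ x₀ n i - state A t₀ x₀ n j ≤ c := by
    -- Every `x₀ l + c` bounds the starting point above, hence also the later value at `i`. Read
    -- backwards, this is a lower bound for the starting point, which the dynamics preserves.
    have h1 : ∀ l, state A t₀ x₀ n i - c ≤ x₀ l := fun l =>
      sub_le_iff_le_add.2 (state_le hA t₀ (fun i => sub_le_iff_le_add'.1 (hx i l)) n i)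
    linarith [le_state hA t₀ h1 n j]
  exact abs_sub_le_iff.2 ⟨h i j, h j i⟩

/-- The values on `S` drop by at most the flow over `S` times the spread of the starting point. -/
theorem sub_mul_flow_le_state (hA : ∀ k, A k ∈ Matrix.rowStochastic ℝ (Fin m)) (t₀ : ℕ)
    {x₀ : Fin m → ℝ} {lo hi a : ℝ} (hlo : ∀ i, lo ≤ x₀ i) (ha : a ≤ hi) (hlh : lo ≤ hi)
    {S : Finset (Fin m)} (hS : ∀ i ∈ S, a ≤ x₀ i) (n : ℕ) {i : Fin m} (hiS : i ∈ S) :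
    a - (hi - lo) * ∑ k ∈ Finset.range n, flow (A (t₀ + k)) S ≤ state A t₀ x₀ n i := by
  induction n generalizing i with
  | zero => simpa [state] using hS i hiS
  | succ n ih =>
    have hF : 0 ≤ ∑ k ∈ Finset.range n, flow (A (t₀ + k)) S :=
      Finset.sum_nonneg fun k _ => flow_nonneg (hA _) S
    rw [Finset.sum_range_succ]
    set F := ∑ k ∈ Finset.range n, flow (A (t₀ + k)) S with hFdef
    set B := A (t₀ + n) with hBdef
    have hB : B ∈ Matrix.rowStochastic ℝ (Fin m) := hA _
    set c := a - (hi - lo) * F with hc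
    have hF' : 0 ≤ (hi - lo) * F := mul_nonneg (by linarith) hF
    have h0 : ∀ j, 0 ≤ B i j := fun j => Matrix.nonneg_of_mem_rowStochastic hB
    have hrow : ∑ j ∈ S, B i j + ∑ j ∈ Sᶜ, B i j = 1 := by
      rw [Finset.sum_add_sum_compl, Matrix.sum_row_of_mem_rowStochastic hB]
    have h1 : ∑ j ∈ S, B i j * c ≤ ∑ j ∈ S, B i j * state A t₀ x₀ n j :=
      Finset.sum_le_sum fun j hj => mul_le_mul_of_nonneg_left (ih hj) (h0 j)
    have h2 : ∑ j ∈ Sᶜ, B i j * lo ≤ ∑ j ∈ Sᶜ, B i j * state A t₀ x₀ n j :=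
      Finset.sum_le_sum fun j _ => mul_le_mul_of_nonneg_left (le_state hA t₀ hlo n j) (h0 j)
    have h3 : state A t₀ x₀ (n + 1) i =
        ∑ j ∈ S, B i j * state A t₀ x₀ n j + ∑ j ∈ Sᶜ, B i j * state A t₀ x₀ n j := by
      rw [Finset.sum_add_sum_compl]
      rfl
    rw [h3]
    rw [← Finset.sum_mul] at h1 h2
    have h4 := sum_compl_row_le_flow hB hiS
    have h5 : 0 ≤ ∑ j ∈ Sᶜ, B i j := Finset.sum_nonneg fun j _ => h0 j
    have h6 : (∑ j ∈ S, B i j) = 1 - ∑ j ∈ Sᶜ, B i j := by linarith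
    rw [h6] at h1
    have h7 : (∑ j ∈ Sᶜ, B i j) * (c - lo) ≤ (∑ j ∈ Sᶜ, B i j) * (hi - lo) :=
      mul_le_mul_of_nonneg_left (by linarith) h5
    have h8 : (∑ j ∈ Sᶜ, B i j) * (hi - lo) ≤ flow B S * (hi - lo) :=
      mul_le_mul_of_nonneg_right h4 (by linarith)
    linarith

/-- Values separated by a gap between `S` and its complement stay separated as long as the
accumulated flow over `S` is small. -/
theorem sub_mul_flow_le_state_sub (hA : ∀ k, A k ∈ Matrix.rowStochastic ℝ (Fin m)) (t₀ : ℕ)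
    {x₀ : Fin m → ℝ} {lo hi a b : ℝ} (hlo : ∀ i, lo ≤ x₀ i) (hhi : ∀ i, x₀ i ≤ hi)
    (ha : a ≤ hi) (hb : lo ≤ b) (hlh : lo ≤ hi)
    {S : Finset (Fin m)} (hS : ∀ i ∈ S, a ≤ x₀ i) (hS' : ∀ i ∉ S, x₀ i ≤ b) (n : ℕ)
    {i j : Fin m} (hiS : i ∈ S) (hj : j ∉ S) :
    a - b - 2 * (hi - lo) * ∑ k ∈ Finset.range n, flow (A (t₀ + k)) S ≤
      state A t₀ x₀ n i - state A t₀ x₀ n j := by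
  have h1 := sub_mul_flow_le_state hA t₀ hlo ha hlh hS n hiS
  have h2 := sub_mul_flow_le_state hA t₀ (x₀ := -x₀) (lo := -hi) (hi := -lo) (a := -b) (S := Sᶜ)
    (fun i => neg_le_neg (hhi i)) (neg_le_neg hb) (neg_le_neg hlh)
    (fun i h => neg_le_neg (hS' i (Finset.mem_compl.1 h))) n (Finset.mem_compl.2 hj)
  rw [state_neg] at h2
  simp only [flow_compl, Pi.neg_apply] at h2
  linarith

/-- Among `m` reals with spread `m * g` there are two consecutive ones at distance at least `g`. -/
theorem exists_gap (x : Fin m → ℝ) {p q : Fin m} {g : ℝ} (hg : 0 < g)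
    (hpq : x p - x q = m * g) :
    ∃ (S : Finset (Fin m)) (a b : ℝ), p ∈ S ∧ q ∉ S ∧ a - b = g ∧
      (∀ i ∈ S, a ≤ x i) ∧ ∀ i ∉ S, x i ≤ b := by
  -- Pigeonhole: the ceilings take at most `m` values, so they miss some `r` among the `m + 1`
  -- integers from `0` to `m`. Then no `x i` lies in the band above `x q + (r - 1) * g` and up to `x
  -- q + r * g`.
  let c : Fin m → ℤ := fun i => ⌈(x i - x q) / g⌉
  have hcq : c q = 0 := by simp [c]
  have hcp : c p = m := by
    simp only [c, hpq]
    rw [mul_div_assoc, div_self hg.ne', mul_one]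
    exact Int.ceil_natCast m
  obtain ⟨r, hr, hrc⟩ : ∃ r ∈ Finset.Icc (0 : ℤ) m, r ∉ Finset.univ.image c := by
    by_contra! h
    have h1 := Finset.card_le_card (show Finset.Icc (0 : ℤ) m ⊆ Finset.univ.image c from h)
    have h2 := (Finset.card_image_le (s := Finset.univ) (f := c))
    simp at h1 h2
    omega
  have hne : ∀ i, c i ≠ r := fun i h => hrc (Finset.mem_image.2 ⟨i, Finset.mem_univ _, h⟩)
  have hrm : r < m := lt_of_le_of_ne (Finset.mem_Icc.1 hr).2 fun h => hne p (hcp.trans h.symm)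
  have hr0 : 0 ≤ r := (Finset.mem_Icc.1 hr).1
  refine ⟨Finset.univ.filter fun i => r < c i, x q + r * g, x q + (r - 1) * g, ?_, ?_, by ring,
    fun i hi => ?_, fun i hi => ?_⟩
  · simpa [hcp] using hrm
  · simpa [hcq] using hr0
  · have h1 : r < ⌈(x i - x q) / g⌉ := (Finset.mem_filter.1 hi).2
    have h2 := Int.lt_ceil.1 h1
    rw [lt_div_iff₀ hg] at h2
    linarith
  · have h1 : c i ≤ r - 1 := by
      have h2 : ¬ r < c i := fun h => hi (Finset.mem_filter.2 ⟨Finset.mem_univ _, h⟩)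
      have := hne i
      omega
    have h2 : (x i - x q) / g ≤ ((r - 1 : ℤ) : ℝ) := Int.ceil_le.1 h1
    rw [div_le_iff₀ hg] at h2
    push_cast at h2
    linarith

theorem flow_mul_sq_le {B : Matrix (Fin m) (Fin m) ℝ} (hB : B ∈ Matrix.rowStochastic ℝ (Fin m))
    {x : Fin m → ℝ} {S : Finset (Fin m)} {d : ℝ} (hd : 0 ≤ d)
    (h : ∀ i ∈ S, ∀ j ∉ S, d ≤ x i - x j) :
    flow B S * d ^ 2 ≤ ∑ i, ∑ j, (B i j + B j i) * (x i - x j) ^ 2 := by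
  have h0 : ∀ i j, 0 ≤ B i j + B j i := fun i j =>
    add_nonneg (Matrix.nonneg_of_mem_rowStochastic hB) (Matrix.nonneg_of_mem_rowStochastic hB)
  have h1 : ∀ i j, 0 ≤ (B i j + B j i) * (x i - x j) ^ 2 := fun i j =>
    mul_nonneg (h0 i j) (sq_nonneg _)
  unfold flow
  simp only [Finset.sum_mul]
  calc ∑ i ∈ S, ∑ j ∈ Sᶜ, (B i j + B j i) * d ^ 2
      ≤ ∑ i ∈ S, ∑ j ∈ Sᶜ, (B i j + B j i) * (x i - x j) ^ 2 :=
        Finset.sum_le_sum fun i hi => Finset.sum_le_sum fun j hj =>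
          mul_le_mul_of_nonneg_left
            (pow_le_pow_left₀ hd (h i hi j (Finset.mem_compl.1 hj)) 2) (h0 i j)
    _ ≤ ∑ i ∈ S, ∑ j, (B i j + B j i) * (x i - x j) ^ 2 :=
        Finset.sum_le_sum fun i _ =>
          Finset.sum_le_sum_of_subset_of_nonneg (Finset.subset_univ _) fun j _ _ => h1 i j
    _ ≤ _ := Finset.sum_le_sum_of_subset_of_nonneg (Finset.subset_univ _)
        fun i _ _ => Finset.sum_nonneg fun j _ => h1 i j

theorem tendsto_sum_flow_add (hflow : HasInfiniteFlowChain A) (t : ℕ) {S : Finset (Fin m)}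
    (hS : S.Nonempty) (hS' : S ≠ Finset.univ) :
    Tendsto (fun n => ∑ k ∈ Finset.range n, flow (A (t + k)) S) atTop atTop := by
  have h1 := (tendsto_add_atTop_iff_nat t).2 (hflow S hS hS')
  have h2 := tendsto_atTop_add_const_right atTop (-∑ k ∈ Finset.range t, flow (A k) S) h1
  refine h2.congr fun n => ?_
  rw [add_comm n t, Finset.sum_range_add]
  ring

/-- Under the infinite flow property, a starting point of spread at least `ε` dissipates a
definite amount within finite time. -/
theorem exists_le_sum_dissipation (hA : ∀ k, A k ∈ Matrix.rowStochastic ℝ (Fin m))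
    (hflow : HasInfiniteFlowChain A) (t : ℕ) (x : Fin m → ℝ) {ε : ℝ} (hε : 0 < ε)
    (hx : ∃ i j, ε ≤ x i - x j) :
    ∃ N, 1 / (4 * m) * (ε / (2 * m)) ^ 2 ≤ ∑ n ∈ Finset.range N, ∑ i, ∑ j,
      (A (t + n) i j + A (t + n) j i) * (state A t x n i - state A t x n j) ^ 2 := by
  obtain ⟨i₀, j₀, hij⟩ := hx
  have : Nonempty (Fin m) := ⟨i₀⟩
  have hm : (0 : ℝ) < m := by exact_mod_cast i₀.pos
  obtain ⟨p, hp⟩ := Finite.exists_max x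
  obtain ⟨q, hq⟩ := Finite.exists_min x
  have hD : ε ≤ x p - x q := by linarith [hp i₀, hq j₀]
  set D := x p - x q with hDdef
  have hD0 : 0 < D := hε.trans_le hD
  obtain ⟨S, a, b, hpS, hqS, hab, hSa, hSb⟩ := exists_gap x (p := p) (q := q) (g := D / m)
    (by positivity) (by field_simp; rfl)
  have htop := tendsto_sum_flow_add hflow t ⟨p, hpS⟩ (fun h => hqS (h ▸ Finset.mem_univ _))
  -- The gap is `D / m` and flow `F` erodes it by at most `2 * D * F`, so half of it survives while
  -- `F ≤ 1 / (4 * m)`. The gap at time `n` depends only on flow before `n`, so the step that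
  -- crosses the threshold still counts in the dissipation.
  have hex : ∃ n, 1 / (4 * m) < ∑ k ∈ Finset.range n, flow (A (t + k)) S :=
    (htop.eventually_gt_atTop (1 / (4 * m : ℝ))).exists
  classical
  refine ⟨Nat.find hex, ?_⟩
  have hsep : ∀ n < Nat.find hex, ∀ i ∈ S, ∀ j ∉ S,
      ε / (2 * m) ≤ state A t x n i - state A t x n j := by
    intro n hn i hi j hj
    have h1 := not_lt.1 (Nat.find_min hex hn)
    have h2 := sub_mul_flow_le_state_sub hA t (lo := x q) (hi := x p) hq hp (hSa p hpS)
      (hSb q hqS) (by linarith) hSa hSb n hi hj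
    have h3 : 2 * D * ∑ k ∈ Finset.range n, flow (A (t + k)) S ≤ 2 * D * (1 / (4 * m)) :=
      mul_le_mul_of_nonneg_left h1 (by positivity)
    have h4 : D / m - 2 * D * (1 / (4 * m)) = D / (2 * m) := by field_simp; norm_num
    have h5 : ε / (2 * m) ≤ D / (2 * m) := by gcongr
    rw [hab] at h2
    linarith
  calc 1 / (4 * m) * (ε / (2 * m)) ^ 2
      ≤ (∑ k ∈ Finset.range (Nat.find hex), flow (A (t + k)) S) * (ε / (2 * m)) ^ 2 :=
        mul_le_mul_of_nonneg_right (Nat.find_spec hex).le (sq_nonneg _)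
    _ ≤ _ := by
        rw [Finset.sum_mul]
        exact Finset.sum_le_sum fun n hn => flow_mul_sq_le (hA _) (by positivity)
          (hsep n (Finset.mem_range.1 hn))

/-- Infinite flow and finite total dissipation force consensus of the trajectory. -/
theorem tendsto_state_sub_of_summable (hA : ∀ k, A k ∈ Matrix.rowStochastic ℝ (Fin m))
    (hflow : HasInfiniteFlowChain A) (t₀ : ℕ) (x₀ : Fin m → ℝ)
    (hsum : Summable fun n => ∑ i, ∑ j,
      (A (t₀ + n) i j + A (t₀ + n) j i) * (state A t₀ x₀ n i - state A t₀ x₀ n j) ^ 2)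
    (i j : Fin m) :
    Tendsto (fun n => state A t₀ x₀ n i - state A t₀ x₀ n j) atTop (𝓝 0) := by
  set f : ℕ → ℝ := fun n => ∑ i, ∑ j,
    (A (t₀ + n) i j + A (t₀ + n) j i) * (state A t₀ x₀ n i - state A t₀ x₀ n j) ^ 2 with hf
  have hf0 : ∀ n, 0 ≤ f n := fun n => Finset.sum_nonneg fun i _ => Finset.sum_nonneg fun j _ =>
    mul_nonneg (add_nonneg (Matrix.nonneg_of_mem_rowStochastic (hA _))
      (Matrix.nonneg_of_mem_rowStochastic (hA _))) (sq_nonneg _)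
  have hm : (0 : ℝ) < m := by exact_mod_cast i.pos
  rw [Metric.tendsto_atTop]
  intro ε hε
  -- One time of small spread suffices, since the spread never grows. Otherwise every tail of the
  -- series would contain the same positive amount of dissipation.
  have hsmall : ∃ s, ∀ i j, state A t₀ x₀ s i - state A t₀ x₀ s j ≤ ε / 2 := by
    by_contra! hlarge
    have hc : (0 : ℝ) < 1 / (4 * m) * (ε / 2 / (2 * m)) ^ 2 := by positivity
    obtain ⟨s, hs⟩ := ((tendsto_sum_nat_add f).eventually_lt_const hc).exists
    obtain ⟨p, q, hpq⟩ := hlarge s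
    obtain ⟨N, hN⟩ := exists_le_sum_dissipation hA hflow (t₀ + s) (state A t₀ x₀ s)
      (half_pos hε) ⟨p, q, hpq.le⟩
    have h1 : ∑ n ∈ Finset.range N, f (n + s) ≤ ∑' n, f (n + s) :=
      ((summable_nat_add_iff s).2 hsum).sum_le_tsum _ fun n _ => hf0 _
    have h2 : ∀ n, f (n + s) = ∑ i, ∑ j, (A (t₀ + s + n) i j + A (t₀ + s + n) j i) *
        (state A (t₀ + s) (state A t₀ x₀ s) n i -
          state A (t₀ + s) (state A t₀ x₀ s) n j) ^ 2 := by
      intro n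
      simp only [hf]
      rw [← state_add, add_comm n s, add_assoc]
    simp only [h2] at h1 hs
    linarith
  obtain ⟨s, hs⟩ := hsmall
  refine ⟨s, fun n hn => ?_⟩
  obtain ⟨k, rfl⟩ := Nat.exists_eq_add_of_le hn
  rw [state_add, Real.dist_0_eq_abs]
  linarith [abs_state_sub_le hA (t₀ + s) hs k i j]

/-- By linearity, finitely many starting points decide ergodicity from a given time. Almost sure
statements can then be combined, although the starting points are uncountable. -/
theorem isErgodicChain_of_single
    (h : ∀ (t₀ : ℕ) (l i j : Fin m), Tendsto (fun n =>
      state A t₀ (Pi.single l 1) n i - state A t₀ (Pi.single l 1) n j) atTop (𝓝 0)) :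
    IsErgodicChain A := by
  intro t₀ x₀ i j
  have h1 : Tendsto (fun n => ∑ l, x₀ l *
      (state A t₀ (Pi.single l 1) n i - state A t₀ (Pi.single l 1) n j)) atTop
      (𝓝 (∑ l, x₀ l * 0)) :=
    tendsto_finsetSum _ fun l _ => (h t₀ l i j).const_mul (x₀ l)
  simp only [mul_zero, Finset.sum_const_zero] at h1
  refine h1.congr fun n => ?_
  rw [state_eq_sum_single A t₀ x₀]
  simp [Finset.sum_apply, mul_sub, Finset.sum_sub_distrib]

/-- An ergodic chain of stochastic matrices has the infinite flow property. -/
theorem IsErgodicChain.hasInfiniteFlowChain (hA : ∀ k, A k ∈ Matrix.rowStochastic ℝ (Fin m))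
    (herg : IsErgodicChain A) : HasInfiniteFlowChain A := by
  intro S ⟨p, hp⟩ hS
  obtain ⟨q, hq⟩ : ∃ q, q ∉ S := by
    by_contra! h
    exact hS (Finset.eq_univ_iff_forall.2 h)
  have hf0 : ∀ k, 0 ≤ flow (A k) S := fun k => flow_nonneg (hA k) S
  rw [← not_summable_iff_tendsto_nat_atTop_of_nonneg hf0]
  intro hsum
  -- From time `t` on, the indicator of `S` loses at most `2 * (1 / 4)` of its unit gap.
  obtain ⟨t, ht⟩ := ((tendsto_sum_nat_add fun k => flow (A k) S).eventually_lt_const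
    (show (0 : ℝ) < 1 / 4 by norm_num)).exists
  let x : Fin m → ℝ := fun i => if i ∈ S then 1 else 0
  have hlow : ∀ n, 1 / 2 ≤ state A t x n p - state A t x n q := by
    intro n
    have h1 := sub_mul_flow_le_state_sub hA t (x₀ := x) (lo := 0) (hi := 1) (a := 1) (b := 0)
      (fun i => by simp only [x]; split_ifs <;> norm_num)
      (fun i => by simp only [x]; split_ifs <;> norm_num) le_rfl le_rfl zero_le_one
      (fun i hi => by simp [x, hi]) (fun i hi => by simp [x, hi]) n hp hq
    have h2 : ∑ k ∈ Finset.range n, flow (A (k + t)) S ≤ ∑' k, flow (A (k + t)) S :=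
      ((summable_nat_add_iff (f := fun k => flow (A k) S) t).2 hsum).sum_le_tsum _
        fun n _ => hf0 _
    simp only [add_comm _ t] at h2 ht
    linarith
  linarith [ge_of_tendsto' (herg t x p q) hlow]

end Deterministic

/-! ### Random chains: independence and almost surely finite dissipation -/

section Stochastic

variable {m : ℕ} {Ω : Type*} [MeasurableSpace Ω] {P : Measure Ω}
  {W : ℕ → Ω → Matrix (Fin m) (Fin m) ℝ}

/-- Stochasticity is not assumed, because this is also applied to finite tuples of arbitrary
matrices extended by zero. -/
theorem measurable_state {A : Ω → ℕ → Matrix (Fin m) (Fin m) ℝ}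
    (hA : ∀ k i j, Measurable fun ω => A ω k i j) (t₀ : ℕ) (x₀ : Fin m → ℝ) (n : ℕ) (i : Fin m) :
    Measurable fun ω => state (A ω) t₀ x₀ n i := by
  induction n generalizing i with
  | zero => exact measurable_const
  | succ n ih =>
    simp only [state, Matrix.mulVec, dotProduct]
    exact Finset.measurable_sum _ fun j _ => (hA _ i j).mul (ih j)

/-- A series of integrable functions whose `L¹` norms are summable converges almost everywhere. -/
theorem ae_summable_of_summable_integral_norm {E : Type*} [NormedAddCommGroup E]
    [CompleteSpace E] {f : ℕ → Ω → E} (hf : ∀ n, Integrable (f n) P)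
    (hsum : Summable fun n => ∫ ω, ‖f n ω‖ ∂P) : ∀ᵐ ω ∂P, Summable fun n => f n ω := by
  have h := summable_norm_of_tsum_eLpNorm_ne_top le_rfl (fun n => (hf n).1) (p := 1) (μ := P) (by
    have h1 : ∀ n, eLpNorm (f n) 1 P = ENNReal.ofReal (∫ ω, ‖f n ω‖ ∂P) := fun n => by
      rw [eLpNorm_one_eq_lintegral_enorm, ofReal_integral_norm_eq_lintegral_enorm (hf n)]
    simp only [h1]
    exact hsum.tsum_ofReal_ne_top)
  filter_upwards [h] with ω hω using hω.of_norm

/-- The matrix applied at time `t₀ + n` is independent of the state at that time. -/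
theorem indepFun_entry_state_sub (hW : IsRandomModel W) (hind : IsIndependent P W) (t₀ : ℕ)
    (x₀ : Fin m → ℝ) (n : ℕ) (i j : Fin m) :
    IndepFun (fun ω => W (t₀ + n) ω i j + W (t₀ + n) ω j i)
      (fun ω => (state (fun k => W k ω) t₀ x₀ n i - state (fun k => W k ω) t₀ x₀ n j) ^ 2) P := by
  classical
  have hind' := iIndepFun.indepFun_finset {t₀ + n} (Finset.range (t₀ + n)) (by simp) hind
    (fun k => measurable_pi_lambda _ fun i => measurable_pi_lambda _ fun j => hW.measurable k i j)
  -- The state is written as a measurable function of the matrices before time `t₀ + n`. The value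
  -- `0` at later times is never used.
  let B : (Finset.range (t₀ + n) → Fin m → Fin m → ℝ) → ℕ → Matrix (Fin m) (Fin m) ℝ :=
    fun w k => if h : k ∈ Finset.range (t₀ + n) then Matrix.of (w ⟨k, h⟩) else 0
  have hB : ∀ k i j, Measurable fun w => B w k i j := by
    intro k i j
    by_cases h : k ∈ Finset.range (t₀ + n)
    · simp only [B, h, dite_true, Matrix.of_apply]
      fun_prop
    · simp only [B, h, dite_false]
      exact measurable_const
  let φ : (({t₀ + n} : Finset ℕ) → Fin m → Fin m → ℝ) → ℝ := fun w =>
    w ⟨t₀ + n, Finset.mem_singleton_self _⟩ i j + w ⟨t₀ + n, Finset.mem_singleton_self _⟩ j i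
  let ψ : (Finset.range (t₀ + n) → Fin m → Fin m → ℝ) → ℝ := fun w =>
    (state (B w) t₀ x₀ n i - state (B w) t₀ x₀ n j) ^ 2
  have hφ : Measurable φ := by fun_prop
  have hψ : Measurable ψ :=
    ((measurable_state hB t₀ x₀ n i).sub (measurable_state hB t₀ x₀ n j)).pow_const 2
  have h := hind'.comp hφ hψ
  have hst : ∀ ω, state (fun k => W k ω) t₀ x₀ n =
      state (B fun k => fun i j => W k ω i j) t₀ x₀ n := fun ω =>
    state_congr x₀ fun k hk => by
      simp only [B, Finset.mem_range.2 hk, dite_true]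
      rfl
  simp only [hst]
  exact h

theorem IsRandomModel.integrable_entry [IsFiniteMeasure P] (hW : IsRandomModel W) (k : ℕ)
    (i j : Fin m) : Integrable (fun ω => W k ω i j) P :=
  Integrable.of_bound (hW.measurable k i j).aestronglyMeasurable 1 <| ae_of_all _ fun ω => by
    rw [Real.norm_of_nonneg (Matrix.nonneg_of_mem_rowStochastic (hW.stochastic k ω))]
    exact Matrix.le_one_of_mem_rowStochastic (hW.stochastic k ω)

theorem IsRandomModel.measurable_state (hW : IsRandomModel W) (t₀ : ℕ) (x₀ : Fin m → ℝ) (n : ℕ)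
    (i : Fin m) : Measurable fun ω => state (fun k => W k ω) t₀ x₀ n i :=
  RandomChain.measurable_state (A := fun ω k => W k ω) hW.measurable t₀ x₀ n i

theorem IsRandomModel.integrable_state_sub_sq [IsFiniteMeasure P] (hW : IsRandomModel W)
    (t₀ : ℕ) (x₀ : Fin m → ℝ) (n : ℕ) (i j : Fin m) :
    Integrable (fun ω =>
      (state (fun k => W k ω) t₀ x₀ n i - state (fun k => W k ω) t₀ x₀ n j) ^ 2) P := by
  refine Integrable.of_bound (((hW.measurable_state t₀ x₀ n i).sub
    (hW.measurable_state t₀ x₀ n j)).pow_const 2).aestronglyMeasurable ((2 * ‖x₀‖) ^ 2)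
    (ae_of_all _ fun ω => ?_)
  rw [norm_pow, Real.norm_eq_abs]
  refine pow_le_pow_left₀ (abs_nonneg _)
    (abs_state_sub_le (fun k => hW.stochastic k ω) t₀ (fun i j => ?_) n i j) 2
  have h1 := abs_le.1 (norm_le_pi_norm x₀ i)
  have h2 := abs_le.1 (norm_le_pi_norm x₀ j)
  linarith [h1.2, h2.1]

theorem H_nonneg (hW : IsRandomModel W) (k : ℕ) (i j : Fin m) : 0 ≤ H P W k i j :=
  integral_nonneg fun ω => by
    rw [Matrix.mul_apply]
    exact Finset.sum_nonneg fun _ _ => mul_nonneg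
      (Matrix.nonneg_of_mem_rowStochastic (hW.stochastic k ω))
      (Matrix.nonneg_of_mem_rowStochastic (hW.stochastic k ω))

/-- In the class `𝓜₂` with weak feedback, the expected dissipation between two coordinates is
summable. -/
theorem IsClassM2.summable_mul_integral (hM2 : IsClassM2 P W) (hW : HasWeakFeedback P W)
    (t₀ : ℕ) (x₀ : Fin m → ℝ) {i j : Fin m} (hij : i < j) :
    Summable fun n => ((∫ ω, W (t₀ + n) ω i j ∂P) + ∫ ω, W (t₀ + n) ω j i ∂P) *
      ∫ ω, (state (fun k => W k ω) t₀ x₀ n i - state (fun k => W k ω) t₀ x₀ n j) ^ 2 ∂P := by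
  obtain ⟨γ, hγ, hfb⟩ := hW
  have hRM := hM2.isRandomModel
  have hE0 : ∀ k i j, 0 ≤ ∫ ω, W k ω i j ∂P := fun k i j =>
    integral_nonneg fun ω => Matrix.nonneg_of_mem_rowStochastic (hRM.stochastic k ω)
  have hD0 : ∀ n i j, 0 ≤ ∫ ω, (state (fun k => W k ω) t₀ x₀ n i -
      state (fun k => W k ω) t₀ x₀ n j) ^ 2 ∂P := fun n i j => integral_nonneg fun ω => sq_nonneg _
  refine Summable.of_nonneg_of_le
    (fun n => mul_nonneg (add_nonneg (hE0 _ _ _) (hE0 _ _ _)) (hD0 n i j)) (fun n => ?_)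
    ((hM2.summable t₀ x₀).mul_left γ⁻¹)
  have h0 : ∀ i j, 0 ≤ H P W (t₀ + n) i j * ∫ ω, (state (fun k => W k ω) t₀ x₀ n i -
      state (fun k => W k ω) t₀ x₀ n j) ^ 2 ∂P := fun i j =>
    mul_nonneg (H_nonneg hRM _ _ _) (hD0 n i j)
  have h1 : H P W (t₀ + n) i j * ∫ ω, (state (fun k => W k ω) t₀ x₀ n i -
      state (fun k => W k ω) t₀ x₀ n j) ^ 2 ∂P ≤ ∑ i : Fin m, ∑ j ∈ Finset.Ioi i,
      H P W (t₀ + n) i j * ∫ ω, (state (fun k => W k ω) t₀ x₀ n i -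
        state (fun k => W k ω) t₀ x₀ n j) ^ 2 ∂P :=
    (Finset.single_le_sum (fun j _ => h0 i j) (Finset.mem_Ioi.2 hij)).trans
      (Finset.single_le_sum (f := fun i => ∑ j ∈ Finset.Ioi i, H P W (t₀ + n) i j *
          ∫ ω, (state (fun k => W k ω) t₀ x₀ n i - state (fun k => W k ω) t₀ x₀ n j) ^ 2 ∂P)
        (fun i _ => Finset.sum_nonneg fun j _ => h0 i j) (Finset.mem_univ i))
  -- The entries of `WᵀW` are by definition the inner products of the columns of `W`.
  have h2 : γ * ((∫ ω, W (t₀ + n) ω i j ∂P) + ∫ ω, W (t₀ + n) ω j i ∂P) ≤ H P W (t₀ + n) i j :=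
    hfb (t₀ + n) i j hij.ne
  rw [inv_mul_eq_div, le_div_iff₀ hγ]
  refine le_trans ?_ h1
  rw [mul_comm, ← mul_assoc]
  exact mul_le_mul_of_nonneg_right h2 (hD0 n i j)

/-- By independence the product of expectations is the expectation of a nonnegative product, so the
summable series is one of `L¹` norms. -/
theorem IsClassM2.ae_summable_pair [IsProbabilityMeasure P] (hM2 : IsClassM2 P W)
    (hW : HasWeakFeedback P W) (t₀ : ℕ) (x₀ : Fin m → ℝ) {i j : Fin m} (hij : i < j) :
    ∀ᵐ ω ∂P, Summable fun n => (W (t₀ + n) ω i j + W (t₀ + n) ω j i) *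
      (state (fun k => W k ω) t₀ x₀ n i - state (fun k => W k ω) t₀ x₀ n j) ^ 2 := by
  have hRM := hM2.isRandomModel
  have hW0 : ∀ k ω i j, 0 ≤ W k ω i j := fun k ω i j =>
    Matrix.nonneg_of_mem_rowStochastic (hRM.stochastic k ω)
  have hint : ∀ n, Integrable (fun ω => W (t₀ + n) ω i j + W (t₀ + n) ω j i) P := fun n =>
    (hRM.integrable_entry _ i j).add (hRM.integrable_entry _ j i)
  have hind := fun n => indepFun_entry_state_sub hRM hM2.isIndependent t₀ x₀ n i j
  refine ae_summable_of_summable_integral_norm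
    (fun n => (hind n).integrable_mul (hint n) (hRM.integrable_state_sub_sq t₀ x₀ n i j)) ?_
  refine (hM2.summable_mul_integral hW t₀ x₀ hij).congr fun n => ?_
  rw [← integral_add (hRM.integrable_entry _ i j) (hRM.integrable_entry _ j i),
    ← (hind n).integral_fun_mul_eq_mul_integral (hint n).1
      (hRM.integrable_state_sub_sq t₀ x₀ n i j).1]
  exact integral_congr_ae (ae_of_all _ fun ω => (Real.norm_of_nonneg
    (mul_nonneg (add_nonneg (hW0 _ _ _ _) (hW0 _ _ _ _)) (sq_nonneg _))).symm)

/-- In the class `𝓜₂` with weak feedback, almost every trajectory has finite total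
dissipation. -/
theorem IsClassM2.ae_summable [IsProbabilityMeasure P] (hM2 : IsClassM2 P W)
    (hW : HasWeakFeedback P W) (t₀ : ℕ) (x₀ : Fin m → ℝ) :
    ∀ᵐ ω ∂P, Summable fun n => ∑ i, ∑ j, (W (t₀ + n) ω i j + W (t₀ + n) ω j i) *
      (state (fun k => W k ω) t₀ x₀ n i - state (fun k => W k ω) t₀ x₀ n j) ^ 2 := by
  have h : ∀ᵐ ω ∂P, ∀ i j : Fin m, i < j →
      Summable fun n => (W (t₀ + n) ω i j + W (t₀ + n) ω j i) *
        (state (fun k => W k ω) t₀ x₀ n i - state (fun k => W k ω) t₀ x₀ n j) ^ 2 := by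
    simp only [ae_all_iff]
    exact fun i j hij => hM2.ae_summable_pair hW t₀ x₀ hij
  filter_upwards [h] with ω hω
  refine summable_sum fun i _ => summable_sum fun j _ => ?_
  -- The class `𝓜₂` controls only `i < j`. Diagonal terms vanish and the summand is symmetric in `i`
  -- and `j`.
  rcases lt_trichotomy i j with hij | rfl | hij
  · exact hω i j hij
  · simp
  · exact (hω j i hij).congr fun n => by ring

end Stochastic

end RandomChain

theorem mainTheorem5 {m : ℕ} {Ω : Type*} [MeasurableSpace Ω] (P : Measure Ω)
    [IsProbabilityMeasure P] (W : ℕ → Ω → Matrix (Fin m) (Fin m) ℝ)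
    (hM2 : RandomChain.IsClassM2 P W) (hW : RandomChain.HasWeakFeedback P W) :
    RandomChain.IsErgodic P W ↔ RandomChain.HasInfiniteFlow P W := by
  have hst := hM2.isRandomModel.stochastic
  constructor
  · intro herg
    filter_upwards [herg] with ω hω using hω.hasInfiniteFlowChain fun k => hst k ω
  · intro hflow
    -- Only countably many pairs of a starting time and a basis vector occur, so one null set serves
    -- them all.
    have hsum := ae_all_iff.2 fun t₀ : ℕ => ae_all_iff.2 fun l : Fin m =>
      hM2.ae_summable hW t₀ (Pi.single l 1)
    filter_upwards [hflow, hsum] with ω hω hs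
    exact RandomChain.isErgodicChain_of_single fun t₀ l =>
      RandomChain.tendsto_state_sub_of_summable (fun k => hst k ω) hω t₀ _ (hs t₀ l)
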